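/- Let $\Bbbk$ be a field and let $Q$ be a finite connected quiver with at least one arrow. Let $J$ be the ideal of the path algebra $\Bbbk Q$ generated by the arrows, and let $I$ be an admissible ideal (that is, a two-sided ideal with $J^n\subseteq I\subseteq J^2$ for some $n$) which is generated by a set of paths, so that $A=\Bbbk Q/I$ is a (finite dimensional, non-simple) monomial algebra. Let $K_0(A)$ be the abelian group generated by the symbols $[M]$, with $M$ a finitely generated right $A$-module, modulo the relations $[M]=[M']+[M'']$ if $M\cong M'\oplus M''$ and $[P]=0$ if $P$ is projective. Let $\bar\Omega:K_0(A)\to K_0(A)$ be the endomorphism induced by the syzygy, $\bar\Omega[M]=[\Omega(M)]$, where $\Omega(M)$ is the kernel of the projective cover of $M$. For $M$ finitely generated, let $\langle \mathrm{add}\, M\rangle$ be the subgroup of $K_0(A)$ generated by the classes of the indecomposable direct summands of $M$, let $$\phi(M)=\min\{\,l\ge 0 : \bar\Omega|_{\bar\Omega^{\,l+s}(\langle \mathrm{add}\, M\rangle)}\text{ is injective for all } s\ge 0\,\},$$ and let $\phi\dim(A)=\sup_M \phi(M)$ over all finitely generated right $A$-modules $M$. If $\phi\dim(A)=0$, then there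 are $m\ge 1$ and $k\ge 2$ such that $Q$ is (isomorphic to) the oriented cycle $C^m$ with $m$ vertices and $m$ arrows, and $I=J^k$. -/

import Mathlib

universe w v u

/-! ### Path algebras of quivers -/

/-- The paths of a quiver (with arbitrary start and target), including the trivial path
at every vertex. `x.1` is the start, `x.2.1` the target, `x.2.2` the path itself. -/
abbrev QuiverPath (V : Type v) [Quiver.{w} V] : Type (max v w) :=
  Σ a b : V, Quiver.Path a b

/-- The path algebra `kQ`: the vector space with basis the paths of the quiver. -/
def PathAlgebra (k : Type u) (V : Type v) [Field k] [Quiver.{w} V] : Type (max u v w) :=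
  QuiverPath V →₀ k

namespace PathAlgebra

noncomputable section

variable (k : Type u) {V : Type v} [Field k] [Quiver.{w} V]

instance : AddCommGroup (PathAlgebra k V) :=
  inferInstanceAs (AddCommGroup (QuiverPath V →₀ k))

instance : Module k (PathAlgebra k V) :=
  inferInstanceAs (Module k (QuiverPath V →₀ k))

/-- A path, seen as a basis element of the path algebra. -/
def ofPath (x : QuiverPath V) : PathAlgebra k V :=
  Finsupp.single x (1 : k)

/-- The paths form a basis of the path algebra. -/
def basis : Module.Basis (QuiverPath V) k (PathAlgebra k V) :=
  Module.Basis.ofRepr (LinearEquiv.refl k (QuiverPath V →₀ k))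

theorem basis_apply (x : QuiverPath V) : basis k x = ofPath k x := rfl

open Classical in
/-- The product of two paths: their concatenation "first `x`, then `y`" if `x` ends where `y`
starts, and zero otherwise. -/
def mulPath (x y : QuiverPath V) : PathAlgebra k V :=
  if h : x.2.1 = y.1 then ofPath k ⟨x.1, y.2.1, x.2.2.comp (y.2.2.cast h.symm rfl)⟩ else 0

/-- The bilinear extension of the product of paths. -/
def mulLin : PathAlgebra k V →ₗ[k] PathAlgebra k V →ₗ[k] PathAlgebra k V :=
  (basis k).constr k fun x => (basis k).constr k fun y => mulPath k x y

theorem mulLin_ofPath (x y : QuiverPath V) :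
    mulLin k (ofPath k x) (ofPath k y) = mulPath k x y := by
  rw [← basis_apply, ← basis_apply, mulLin, Module.Basis.constr_basis, Module.Basis.constr_basis]

theorem mulPath_comp {a b c : V} (p : Quiver.Path a b) (q : Quiver.Path b c) :
    mulPath k ⟨a, b, p⟩ ⟨b, c, q⟩ = ofPath k ⟨a, c, p.comp q⟩ := by
  simp [mulPath]

theorem mulPath_of_ne {x y : QuiverPath V} (h : x.2.1 ≠ y.1) : mulPath k x y = 0 := by
  simp [mulPath, h]

theorem mulLin_assoc (f g h : PathAlgebra k V) :
    mulLin k (mulLin k f g) h = mulLin k f (mulLin k g h) := by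
  have key : ∀ x y z : QuiverPath V,
      mulLin k (mulPath k x y) (ofPath k z) = mulLin k (ofPath k x) (mulPath k y z) := by
    rintro ⟨a, b, p⟩ ⟨b', c, q⟩ ⟨c', d, r⟩
    by_cases h₁ : b = b'
    · subst h₁
      by_cases h₂ : c = c'
      · subst h₂
        rw [mulPath_comp, mulPath_comp, mulLin_ofPath, mulLin_ofPath, mulPath_comp, mulPath_comp,
          Quiver.Path.comp_assoc]
      · rw [mulPath_comp, mulLin_ofPath, mulPath_of_ne k (x := ⟨a, c, _⟩) h₂,
          mulPath_of_ne k (x := ⟨b, c, _⟩) h₂, map_zero]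
    · rw [mulPath_of_ne k (x := ⟨a, b, _⟩) h₁, map_zero, LinearMap.zero_apply]
      by_cases h₂ : c = c'
      · subst h₂
        rw [mulPath_comp, mulLin_ofPath, mulPath_of_ne k (x := ⟨a, b, _⟩) h₁]
      · rw [mulPath_of_ne k (x := ⟨b', c, _⟩) h₂, map_zero]
  have e : (mulLin k).compr₂ (mulLin k (V := V)) =
      (LinearMap.llcomp k _ _ _).flip (mulLin k) ∘ₗ
        (LinearMap.llcomp k _ _ _ ∘ₗ mulLin k (V := V)) := by
    refine (basis k).ext fun x => (basis k).ext fun y => (basis k).ext fun z => ?_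
    simp only [basis_apply, LinearMap.compr₂_apply, LinearMap.comp_apply, LinearMap.flip_apply,
      LinearMap.llcomp_apply, mulLin_ofPath]
    exact key x y z
  exact LinearMap.congr_fun (LinearMap.congr_fun (LinearMap.congr_fun e f) g) h

instance : Mul (PathAlgebra k V) := ⟨fun f g => mulLin k f g⟩

theorem mul_def (f g : PathAlgebra k V) : f * g = mulLin k f g := rfl

theorem ofPath_mul_ofPath (x y : QuiverPath V) : ofPath k x * ofPath k y = mulPath k x y :=
  mulLin_ofPath k x y

section Unital

variable [Fintype V]

/-- The identity of the path algebra is the sum of the trivial paths. -/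
instance : One (PathAlgebra k V) := ⟨∑ a : V, ofPath k ⟨a, a, Quiver.Path.nil⟩⟩

theorem one_def : (1 : PathAlgebra k V) = ∑ a : V, ofPath k ⟨a, a, Quiver.Path.nil⟩ := rfl

theorem mulLin_one_left (f : PathAlgebra k V) : mulLin k 1 f = f := by
  have e : mulLin k (1 : PathAlgebra k V) = LinearMap.id := by
    refine (basis k).ext ?_
    rintro ⟨a, b, p⟩
    rw [basis_apply, one_def, map_sum, LinearMap.sum_apply, Finset.sum_eq_single a]
    · rw [mulLin_ofPath, mulPath_comp, Quiver.Path.nil_comp, LinearMap.id_apply]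
    · intro c _ hc
      rw [mulLin_ofPath, mulPath_of_ne k (x := ⟨c, c, _⟩) hc]
    · simp
  exact LinearMap.congr_fun e f

theorem mulLin_one_right (f : PathAlgebra k V) : mulLin k f 1 = f := by
  have e : (mulLin k).flip (1 : PathAlgebra k V) = LinearMap.id := by
    refine (basis k).ext ?_
    rintro ⟨a, b, p⟩
    rw [basis_apply, one_def, LinearMap.flip_apply, map_sum, Finset.sum_eq_single b]
    · rw [mulLin_ofPath, mulPath_comp, Quiver.Path.comp_nil, LinearMap.id_apply]
    · intro c _ hc
      rw [mulLin_ofPath, mulPath_of_ne k (x := ⟨a, b, _⟩) (Ne.symm hc)]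
    · simp
  exact LinearMap.congr_fun e f

instance : Ring (PathAlgebra k V) :=
  { (inferInstance : AddCommGroup (PathAlgebra k V)),
    (inferInstance : Mul (PathAlgebra k V)),
    (inferInstance : One (PathAlgebra k V)) with
    left_distrib := fun f g h => (mulLin k f).map_add g h
    right_distrib := fun f g h => by
      simp only [mul_def, map_add, LinearMap.add_apply]
    zero_mul := fun f => by simp only [mul_def, map_zero, LinearMap.zero_apply]
    mul_zero := fun f => by simp only [mul_def, map_zero]
    mul_assoc := mulLin_assoc k
    one_mul := mulLin_one_left k
    mul_one := mulLin_one_right k }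

instance : Algebra k (PathAlgebra k V) :=
  Algebra.ofModule
    (fun r f g => by simp only [mul_def, map_smul, LinearMap.smul_apply])
    (fun r f g => by simp only [mul_def, map_smul])

variable (V) in
/-- The arrow ideal `J`: the two-sided ideal of the path algebra generated by the arrows.
Its powers `J ^ n` are the usual powers of (two-sided) ideals. -/
def arrowIdeal : Ideal (PathAlgebra k V) :=
  (TwoSidedIdeal.span {x : PathAlgebra k V | ∃ (a b : V) (e : a ⟶ b),
    x = ofPath k ⟨a, b, e.toPath⟩}).asIdeal

instance : (arrowIdeal k V).IsTwoSided := by unfold arrowIdeal; infer_instance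

variable {k}

/-- A two-sided ideal `I` of the path algebra is admissible if `J ^ n ⊆ I ⊆ J ^ 2`
for some `n`. -/
class IsAdmissible (I : Ideal (PathAlgebra k V)) : Prop extends I.IsTwoSided where
  exists_pow_le : ∃ n : ℕ, arrowIdeal k V ^ n ≤ I
  le_sq : I ≤ arrowIdeal k V ^ 2

/-- A two-sided ideal of the path algebra is monomial if it is generated, as a two-sided ideal,
by a set of paths. -/
def IsMonomial (I : Ideal (PathAlgebra k V)) : Prop :=
  ∃ S : Set (QuiverPath V), I = (TwoSidedIdeal.span (ofPath k '' S)).asIdeal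

theorem ofPath_mem_pow (n : ℕ) : ∀ {a b : V} (p : Quiver.Path a b), n ≤ p.length →
    ofPath k ⟨a, b, p⟩ ∈ arrowIdeal k V ^ n := by
  induction n with
  | zero => intro a b p _; rw [Submodule.pow_zero]; simp
  | succ n ih =>
    intro a b p hp
    cases p with
    | nil => simp at hp
    | cons p e =>
      have h₁ := ih p (by simpa using hp)
      rw [Ideal.IsTwoSided.pow_add, Submodule.pow_one]
      have h₂ : ofPath k ⟨_, _, e.toPath⟩ ∈ arrowIdeal k V :=
        TwoSidedIdeal.mem_asIdeal.2 (TwoSidedIdeal.subset_span ⟨_, _, e, rfl⟩)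
      have := Ideal.mul_mem_mul h₁ h₂
      rw [ofPath_mul_ofPath, mulPath_comp] at this
      exact this

theorem finite_paths_lt [∀ a b : V, Finite (a ⟶ b)] (n : ℕ) :
    {x : QuiverPath V | x.2.2.length < n}.Finite := by
  induction n with
  | zero => simp
  | succ n ih =>
    have h₀ : (Set.range fun a : V => (⟨a, a, Quiver.Path.nil⟩ : QuiverPath V)).Finite :=
      Set.finite_range _
    have h₁ : (⋃ x ∈ {x : QuiverPath V | x.2.2.length < n},
        Set.range fun e : (Σ c : V, x.2.1 ⟶ c) =>
          (⟨x.1, e.1, x.2.2.cons e.2⟩ : QuiverPath V)).Finite :=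
      ih.biUnion fun x _ => Set.finite_range _
    refine (h₀.union h₁).subset ?_
    rintro ⟨a, b, p⟩ hp
    cases p with
    | nil => exact Or.inl ⟨a, rfl⟩
    | cons p e =>
      refine Or.inr (Set.mem_biUnion (x := ⟨a, _, p⟩) ?_ ⟨⟨b, e⟩, rfl⟩)
      simpa using hp

/-- The quotient of the path algebra of a finite quiver by an admissible ideal is
finite dimensional. -/
instance finite_quotient [∀ a b : V, Finite (a ⟶ b)] (I : Ideal (PathAlgebra k V))
    [IsAdmissible I] : Module.Finite k (PathAlgebra k V ⧸ I) := by
  obtain ⟨n, hn⟩ := IsAdmissible.exists_pow_le (I := I)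
  let π : PathAlgebra k V →ₐ[k] PathAlgebra k V ⧸ I := Ideal.Quotient.mkₐ k I
  refine ⟨Submodule.fg_def.2 ⟨(fun x => π (ofPath k x)) '' {x : QuiverPath V | x.2.2.length < n},
    (finite_paths_lt n).image _, ?_⟩⟩
  rw [eq_top_iff]
  have h₁ : (⊤ : Submodule k (PathAlgebra k V ⧸ I)) =
      Submodule.map π.toLinearMap (Submodule.span k (Set.range (basis k))) := by
    rw [(basis k).span_eq, Submodule.map_top, LinearMap.range_eq_top.2]
    exact Ideal.Quotient.mkₐ_surjective k I
  rw [h₁, Submodule.map_span_le]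
  rintro _ ⟨⟨a, b, p⟩, rfl⟩
  rw [basis_apply]
  by_cases hp : p.length < n
  · exact Submodule.subset_span ⟨⟨a, b, p⟩, hp, rfl⟩
  · have h₂ : ofPath k ⟨a, b, p⟩ ∈ I := hn (ofPath_mem_pow n p (not_lt.1 hp))
    have h₃ : π.toLinearMap (ofPath k ⟨a, b, p⟩) = 0 := Ideal.Quotient.eq_zero_iff_mem.2 h₂
    rw [h₃]
    exact Submodule.zero_mem _

/-- The opposite of the quotient by an admissible ideal is left artinian, that is, the quotient
is a right artinian ring. -/
instance isArtinianRing_op_quotient [∀ a b : V, Finite (a ⟶ b)] (I : Ideal (PathAlgebra k V))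
    [IsAdmissible I] : IsArtinianRing (PathAlgebra k V ⧸ I)ᵐᵒᵖ := by
  have : Module.Finite k (PathAlgebra k V ⧸ I)ᵐᵒᵖ :=
    Module.Finite.equiv (MulOpposite.opLinearEquiv k (M := PathAlgebra k V ⧸ I))
  have : IsArtinian k (PathAlgebra k V ⧸ I)ᵐᵒᵖ := inferInstance
  exact isArtinian_of_tower k this

end Unital

end

end PathAlgebra

/-! ### The Igusa-Todorov function -/

namespace IgusaTodorov

noncomputable section

/-- A projective cover of a module: a surjection from a projective module whose kernel is
superfluous. -/
structure IsProjectiveCover {R : Type u} [Ring R] {P M : Type u} [AddCommGroup P] [Module R P]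
    [AddCommGroup M] [Module R M] (f : P →ₗ[R] M) : Prop where
  projective : Module.Projective R P
  surjective : Function.Surjective f
  superfluous : ∀ N : Submodule R P, N ⊔ LinearMap.ker f = ⊤ → N = ⊤

/-- A module is indecomposable if it is nonzero and is not the direct sum of two nonzero
submodules. -/
def IsIndecomposable (R : Type u) [Ring R] (M : Type u) [AddCommGroup M] [Module R M] : Prop :=
  Nontrivial M ∧ ∀ A B : Submodule R M, IsCompl A B → A = ⊥ ∨ B = ⊥

variable (R : Type u) [Ring R]

/-- The defining relations of `K₀`: `[M] - [M'] - [M'']` whenever `M ≅ M' ⊕ M''`, and `[P]` for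
projective `P`. -/
def relations : Set (FreeAbelianGroup (FGModuleCat.{u} R)) :=
  {x | ∃ M M' M'' : FGModuleCat.{u} R, Nonempty (M ≃ₗ[R] M' × M'') ∧
    x = FreeAbelianGroup.of M - FreeAbelianGroup.of M' - FreeAbelianGroup.of M''} ∪
  {x | ∃ P : FGModuleCat.{u} R, Module.Projective R P ∧ x = FreeAbelianGroup.of P}

/-- The group `K₀` of Igusa and Todorov: generated by the symbols `[M]`, with `M` a finitely
generated module, modulo `[M] = [M'] + [M'']` if `M ≅ M' ⊕ M''` and `[P] = 0` for projective
`P`. -/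
abbrev K₀ : Type (u + 1) :=
  FreeAbelianGroup (FGModuleCat.{u} R) ⧸ AddSubgroup.closure (relations R)

variable {R}

/-- The class `[M]` in `K₀`. -/
def cls (M : FGModuleCat.{u} R) : K₀ R :=
  QuotientAddGroup.mk (FreeAbelianGroup.of M)

theorem cls_eq_add {M M' M'' : FGModuleCat.{u} R} (e : M ≃ₗ[R] M' × M'') :
    cls M = cls M' + cls M'' := by
  have h : (QuotientAddGroup.mk (FreeAbelianGroup.of M - FreeAbelianGroup.of M' -
      FreeAbelianGroup.of M'') : K₀ R) = 0 :=
    (QuotientAddGroup.eq_zero_iff _).2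
      (AddSubgroup.subset_closure (Or.inl ⟨M, M', M'', ⟨e⟩, rfl⟩))
  have h' : cls M - cls M' - cls M'' = 0 := h
  rw [sub_sub, sub_eq_zero] at h'
  exact h'

theorem cls_projective (P : FGModuleCat.{u} R) (hP : Module.Projective R P) : cls P = 0 :=
  (QuotientAddGroup.eq_zero_iff _).2 (AddSubgroup.subset_closure (Or.inr ⟨P, hP, rfl⟩))

/-- The subgroup `⟨add M⟩` of `K₀` generated by the classes of the indecomposable direct summands
of `M`. -/
def addSubgroup (M : FGModuleCat.{u} R) : AddSubgroup (K₀ R) :=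
  AddSubgroup.closure {x | ∃ N L : FGModuleCat.{u} R, IsIndecomposable R N ∧
    Nonempty (M ≃ₗ[R] N × L) ∧ x = cls N}

section Artinian

variable [IsArtinianRing R]

/-- Every finitely generated module over a left artinian ring has a projective cover. -/
theorem exists_projectiveCover (M : FGModuleCat.{u} R) :
    ∃ (P : FGModuleCat.{u} R) (f : P →ₗ[R] M), IsProjectiveCover f := by
  obtain ⟨n, f, hf⟩ := Module.Finite.exists_fin' R M
  obtain ⟨N, hN, hmin⟩ := IsArtinian.set_has_minimal
    {N : Submodule R (Fin n → R) | N ⊔ LinearMap.ker f = ⊤} ⟨⊤, by simp⟩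
  have surj_iff : ∀ L : Submodule R (Fin n → R),
      L ⊔ LinearMap.ker f = ⊤ ↔ L.map f = ⊤ := by
    intro L
    rw [← Submodule.comap_map_eq]
    constructor
    · intro h
      rw [← Submodule.map_comap_eq_of_surjective hf (L.map f), h, Submodule.map_top,
        LinearMap.range_eq_top.2 hf]
    · intro h; rw [h, Submodule.comap_top]
  have hfN : Function.Surjective (f ∘ₗ N.subtype) := by
    rw [← LinearMap.range_eq_top, LinearMap.range_comp, Submodule.range_subtype]
    exact (surj_iff N).1 hN
  have hle : ∀ L : Submodule R (Fin n → R), L ≤ N → L.map f = ⊤ → L = N := by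
    intro L hL h
    by_contra hne
    exact hmin L ((surj_iff L).2 h) (lt_of_le_of_ne hL hne)
  obtain ⟨g, hg⟩ := Module.projective_lifting_property (f ∘ₗ N.subtype) f hfN
  have hgN : Function.Surjective (g ∘ₗ N.subtype) := by
    have h₁ : (N.map g).map N.subtype = N := by
      apply hle _ (Submodule.map_subtype_le N _)
      rw [← Submodule.map_comp, ← Submodule.map_comp, hg]
      exact (surj_iff N).1 hN
    rw [← LinearMap.range_eq_top, LinearMap.range_comp, Submodule.range_subtype]
    apply Submodule.map_injective_of_injective N.injective_subtype
    rw [h₁, Submodule.map_subtype_top]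
  have hbij := IsNoetherian.bijective_of_surjective_endomorphism _ hgN
  let e : N ≃ₗ[R] N := LinearEquiv.ofBijective _ hbij
  have hproj : Module.Projective R N := by
    refine Module.Projective.of_split (N.subtype ∘ₗ e.symm.toLinearMap) g ?_
    refine LinearMap.ext fun x => ?_
    exact e.apply_symm_apply x
  refine ⟨FGModuleCat.of R N, f ∘ₗ N.subtype, hproj, hfN, ?_⟩
  intro L hL
  have h₁ : (L.map N.subtype).map f = ⊤ := by
    rw [← Submodule.map_comp]
    have h₂ := congrArg (Submodule.map (f ∘ₗ N.subtype)) hL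
    rw [Submodule.map_sup, Submodule.map_top, LinearMap.range_eq_top.2 hfN] at h₂
    have h₃ : Submodule.map (f ∘ₗ N.subtype) (LinearMap.ker (f ∘ₗ N.subtype)) = ⊥ := by
      rw [eq_bot_iff]
      rintro _ ⟨x, hx, rfl⟩
      exact hx
    rw [h₃, sup_bot_eq] at h₂
    exact h₂
  have h₂ := hle _ (Submodule.map_subtype_le N L) h₁
  apply Submodule.map_injective_of_injective N.injective_subtype
  rw [Submodule.map_subtype_top]
  exact h₂

/-- The projective cover `P(M)` of `M`. -/
def projectiveCover (M : FGModuleCat.{u} R) : FGModuleCat.{u} R :=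
  (exists_projectiveCover M).choose

/-- The surjection `P(M) → M`. -/
def projectiveCoverMap (M : FGModuleCat.{u} R) : projectiveCover M →ₗ[R] M :=
  (exists_projectiveCover M).choose_spec.choose

theorem isProjectiveCover_projectiveCoverMap (M : FGModuleCat.{u} R) :
    IsProjectiveCover (projectiveCoverMap M) :=
  (exists_projectiveCover M).choose_spec.choose_spec

/-- The syzygy `Ω(M)`: the kernel of the projective cover `P(M) → M`. -/
def syzygy (M : FGModuleCat.{u} R) : FGModuleCat.{u} R :=
  FGModuleCat.of R (LinearMap.ker (projectiveCoverMap M))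

/-- Schanuel's lemma, as an identity in `K₀`. -/
theorem cls_ker_eq {P P' M : FGModuleCat.{u} R} (f : P →ₗ[R] M) (f' : P' →ₗ[R] M)
    (hP : Module.Projective R P) (hP' : Module.Projective R P')
    (hf : Function.Surjective f) (hf' : Function.Surjective f') :
    cls (FGModuleCat.of R (LinearMap.ker f)) = cls (FGModuleCat.of R (LinearMap.ker f')) := by
  have main : ∀ {P P' : FGModuleCat.{u} R} (f : P →ₗ[R] M) (f' : P' →ₗ[R] M)
      (_ : Module.Projective R P) (_ : Function.Surjective f'),
      cls (FGModuleCat.of R (LinearMap.ker (f.coprod f'))) =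
        cls (FGModuleCat.of R (LinearMap.ker f')) := by
    intro P P' f f' hP hf'
    obtain ⟨s, hs⟩ := Module.projective_lifting_property f' f hf'
    have hs' : ∀ x, f' (s x) = f x := fun x => LinearMap.congr_fun hs x
    have e : LinearMap.ker (f.coprod f') ≃ₗ[R] LinearMap.ker f' × P :=
      { toFun := fun z => (⟨z.1.2 + s z.1.1, by
          have := z.2
          rw [LinearMap.mem_ker, LinearMap.coprod_apply] at this
          rw [LinearMap.mem_ker, map_add, hs', add_comm, this]⟩, z.1.1)
        invFun := fun w => ⟨(w.2, w.1.1 - s w.2), by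
          have := w.1.2
          rw [LinearMap.mem_ker] at this
          rw [LinearMap.mem_ker, LinearMap.coprod_apply, map_sub, hs', this]
          simp⟩
        map_add' := fun z z' => by
          ext <;> simp
          abel
        map_smul' := fun r z => by
          ext <;> simp
        left_inv := fun z => by
          ext <;> simp
        right_inv := fun w => by
          ext <;> simp }
    have h := cls_eq_add (M := FGModuleCat.of R (LinearMap.ker (f.coprod f')))
      (M' := FGModuleCat.of R (LinearMap.ker f')) (M'' := P) e
    rw [h, cls_projective P hP, add_zero]
  have swap : cls (FGModuleCat.of R (LinearMap.ker (f.coprod f'))) =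
      cls (FGModuleCat.of R (LinearMap.ker (f'.coprod f))) := by
    have e₀ : LinearMap.ker (f.coprod f') ≃ₗ[R] LinearMap.ker (f'.coprod f) :=
      { toFun := fun z => ⟨(z.1.2, z.1.1), by
          have := z.2
          rw [LinearMap.mem_ker, LinearMap.coprod_apply] at this ⊢
          rw [add_comm]; exact this⟩
        invFun := fun z => ⟨(z.1.2, z.1.1), by
          have := z.2
          rw [LinearMap.mem_ker, LinearMap.coprod_apply] at this ⊢
          rw [add_comm]; exact this⟩
        map_add' := fun _ _ => rfl
        map_smul' := fun _ _ => rfl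
        left_inv := fun _ => rfl
        right_inv := fun _ => rfl }
    have h := cls_eq_add (M := FGModuleCat.of R (LinearMap.ker (f.coprod f')))
      (M' := FGModuleCat.of R (LinearMap.ker (f'.coprod f)))
      (M'' := FGModuleCat.of R PUnit.{u + 1}) (e₀.trans LinearEquiv.prodUnique.symm)
    have h₀ := cls_projective (FGModuleCat.of R PUnit.{u + 1})
      (inferInstanceAs (Module.Projective R PUnit.{u + 1}))
    rw [h, h₀, add_zero]
  rw [← main f' f hP' hf, ← swap, main f f' hP hf']

/-- The class of the kernel of any surjection from a finitely generated projective module is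
the class of the syzygy. -/
theorem cls_syzygy_eq {P M : FGModuleCat.{u} R} (f : P →ₗ[R] M) (hP : Module.Projective R P)
    (hf : Function.Surjective f) :
    cls (syzygy M) = cls (FGModuleCat.of R (LinearMap.ker f)) :=
  cls_ker_eq (projectiveCoverMap M) f (isProjectiveCover_projectiveCoverMap M).projective hP
    (isProjectiveCover_projectiveCoverMap M).surjective hf

theorem cls_syzygy_projective (P : FGModuleCat.{u} R) (hP : Module.Projective R P) :
    cls (syzygy P) = 0 := by
  rw [cls_syzygy_eq (LinearMap.id : P →ₗ[R] P) hP Function.surjective_id]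
  apply cls_projective
  have : Subsingleton (LinearMap.ker (LinearMap.id : P →ₗ[R] P)) := by
    rw [LinearMap.ker_id]; infer_instance
  exact Module.Projective.of_free

theorem cls_syzygy_add {M M' M'' : FGModuleCat.{u} R} (e : M ≃ₗ[R] M' × M'') :
    cls (syzygy M) = cls (syzygy M') + cls (syzygy M'') := by
  have h' := isProjectiveCover_projectiveCoverMap M'
  have h'' := isProjectiveCover_projectiveCoverMap M''
  have p' := h'.projective
  have p'' := h''.projective
  let f : FGModuleCat.of R (projectiveCover M' × projectiveCover M'') →ₗ[R] M :=
    e.symm.toLinearMap ∘ₗ (projectiveCoverMap M').prodMap (projectiveCoverMap M'')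
  have hf : Function.Surjective f :=
    e.symm.surjective.comp (Function.Surjective.prodMap h'.surjective h''.surjective)
  rw [cls_syzygy_eq f (inferInstanceAs
    (Module.Projective R (projectiveCover M' × projectiveCover M''))) hf]
  have hker : ∀ z : projectiveCover M' × projectiveCover M'', z ∈ LinearMap.ker f ↔
      projectiveCoverMap M' z.1 = 0 ∧ projectiveCoverMap M'' z.2 = 0 := by
    intro z
    change e.symm (projectiveCoverMap M' z.1, projectiveCoverMap M'' z.2) = 0 ↔ _
    rw [LinearEquiv.map_eq_zero_iff, Prod.mk_eq_zero]
  have e₀ : LinearMap.ker f ≃ₗ[R]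
      LinearMap.ker (projectiveCoverMap M') × LinearMap.ker (projectiveCoverMap M'') :=
    { toFun := fun z => (⟨z.1.1, ((hker z.1).1 z.2).1⟩, ⟨z.1.2, ((hker z.1).1 z.2).2⟩)
      invFun := fun w => ⟨(w.1.1, w.2.1), (hker _).2 ⟨w.1.2, w.2.2⟩⟩
      map_add' := fun _ _ => rfl
      map_smul' := fun _ _ => rfl
      left_inv := fun _ => rfl
      right_inv := fun _ => rfl }
  exact cls_eq_add (M := FGModuleCat.of R (LinearMap.ker f)) (M' := syzygy M')
    (M'' := syzygy M'') e₀

variable (R) in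
/-- The endomorphism `Ω̄` of `K₀` induced by the syzygy: `Ω̄ [M] = [Ω(M)]`. -/
def syzygyHom : K₀ R →+ K₀ R :=
  QuotientAddGroup.lift (AddSubgroup.closure (relations R))
    (FreeAbelianGroup.lift fun M => cls (syzygy M)) (by
      rw [AddSubgroup.closure_le]
      rintro x (⟨M, M', M'', ⟨e⟩, rfl⟩ | ⟨P, hP, rfl⟩)
      · simp [cls_syzygy_add e]
      · simp [cls_syzygy_projective P hP])

theorem syzygyHom_cls (M : FGModuleCat.{u} R) : syzygyHom R (cls M) = cls (syzygy M) := by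
  simp [syzygyHom, cls]

/-- The Igusa-Todorov function `φ(M)`: the least `l` such that `Ω̄` is injective on
`Ω̄ ^ (l + s) ⟨add M⟩` for all `s ≥ 0`. -/
def phi (M : FGModuleCat.{u} R) : ℕ∞ :=
  ⨅ l ∈ {l : ℕ | ∀ s : ℕ, Set.InjOn (syzygyHom R)
    ((syzygyHom R)^[l + s] '' (addSubgroup M : Set (K₀ R)))}, (l : ℕ∞)

variable (R) in
/-- The `φ`-dimension of (left modules over) a left artinian ring `R`: the supremum of `φ(M)`
over all finitely generated modules `M`. -/
def phiDim : ℕ∞ :=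
  ⨆ M : FGModuleCat.{u} R, phi M

end Artinian

end

end IgusaTodorov

/-! ### Oriented cycles -/

/-- The vertices of the oriented cycle `C^m`, for `m ≥ 1`. -/
def OrientedCycle (m : ℕ) : Type := ZMod m

/-- There is exactly one arrow `i ⟶ i + 1` for every vertex `i`, and no other arrow. -/
instance (m : ℕ) : Quiver.{0} (OrientedCycle m) where
  Hom := fun i j : ZMod m => PLift (j = i + 1)

/-- An isomorphism of quivers. -/
structure QuiverIso (V : Type v) (W : Type u) [Quiver V] [Quiver W] where
  vertexEquiv : V ≃ W
  arrowEquiv : ∀ a b : V, (a ⟶ b) ≃ (vertexEquiv a ⟶ vertexEquiv b)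

/-- A quiver is connected if it has a vertex and any two vertices are joined by a path of the
underlying undirected graph. -/
def QuiverConnected (V : Type v) [Quiver V] : Prop :=
  Nonempty V ∧ Subsingleton (Quiver.WeaklyConnectedComponent V)

/-!
Write `R` for the opposite of `A = kQ / I`, so that left `R`-modules are right `A`-modules. The proof
goes through self-injectivity of `R` and then through the combinatorics of nonzero paths.

*Self-injectivity.* If `φdim R = 0`, then `Ω̄` is injective on every `⟨add M⟩`, so the class of a
module in `K₀` is determined by the class of its syzygy (`cls_eq_of_cls_syzygy_eq`). Let
`0 → R → E → C → 0` be exact and let `P → E` be a surjection from a projective module. The kernel of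
`P → E → C` is an extension of `R` by the kernel of `P → E`, hence the direct sum of the two; so
`[Ω C] = [Ω E]` and `[C] = [E]`. The function `M ↦ dim Ext¹(M, R)`, written as the alternating sum
of the dimensions of `Hom(-, R)` along a projective presentation, is additive and vanishes on
projectives, so it is defined on `K₀` (`dualEulerHom`) and takes the same value on `C` and `E`. This
equality of dimensions says that `Hom(E, R) → Hom(R, R)` is surjective, so the sequence splits
(`exists_retraction_of_phiDim_eq_zero`).

*Maximal nonzero paths.* Call a nonzero path right-maximal if it is killed by every arrow on the
right. Two right-maximal paths `p` and `q` with the same end generate isomorphic simple right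
ideals; by self-injectivity the isomorphism is left multiplication by an element of `A`, and as `I`
is spanned by paths, each of `p` and `q` is a final segment of the other. So a right-maximal path is
determined by its end (`PathAlgebra.eq_of_isRightMaximal`). Every vertex is the start of a
right-maximal path, so by counting vertices there is exactly one such path with a given start, and
exactly one with a given end. Hence every vertex has exactly one outgoing arrow and exactly one
incoming arrow, and the connected quiver is an oriented cycle. Finally the length of the
right-maximal path starting at a vertex does not decrease along arrows, so it is constant on the
cycle, equal to `r - 1` say, and the zero paths are those of length at least `r`.
-/

namespace IgusaTodorov

noncomputable section

/-! ### The Euler characteristic of `Hom(-, R)` on `K₀` -/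

section Dual

variable {R : Type u} [Ring R]

/-- One half of Schanuel's lemma: the pullback of a surjection `f'` and a map `f` from a projective
module `P` is the direct sum of the kernel of `f'` and `P`. -/
theorem nonempty_ker_coprod_equiv {P P' M : Type*} [AddCommGroup P] [Module R P]
    [AddCommGroup P'] [Module R P'] [AddCommGroup M] [Module R M] [Module.Projective R P]
    (f : P →ₗ[R] M) (f' : P' →ₗ[R] M) (hf' : Function.Surjective f') :
    Nonempty (LinearMap.ker (f.coprod f') ≃ₗ[R] LinearMap.ker f' × P) := by
  obtain ⟨s, hs⟩ := Module.projective_lifting_property f' f hf'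
  have hs' : ∀ x, f' (s x) = f x := fun x => LinearMap.congr_fun hs x
  exact ⟨
    { toFun := fun z => (⟨z.1.2 + s z.1.1, by
        have := z.2
        rw [LinearMap.mem_ker, LinearMap.coprod_apply] at this
        rw [LinearMap.mem_ker, map_add, hs', add_comm, this]⟩, z.1.1)
      invFun := fun w => ⟨(w.2, w.1.1 - s w.2), by
        have := w.1.2
        rw [LinearMap.mem_ker] at this
        rw [LinearMap.mem_ker, LinearMap.coprod_apply, map_sub, hs', this]
        simp⟩
      map_add' := fun z z' => by
        ext <;> simp
        abel
      map_smul' := fun r z => by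
        ext <;> simp
      left_inv := fun z => by
        ext <;> simp
      right_inv := fun w => by
        ext <;> simp }⟩

/-- Interchanging the two maps does not change their pullback. -/
def kerCoprodSwap {P P' M : Type*} [AddCommGroup P] [Module R P]
    [AddCommGroup P'] [Module R P'] [AddCommGroup M] [Module R M]
    (f : P →ₗ[R] M) (f' : P' →ₗ[R] M) :
    LinearMap.ker (f.coprod f') ≃ₗ[R] LinearMap.ker (f'.coprod f) where
  toFun z := ⟨(z.1.2, z.1.1), by
    have := z.2
    rw [LinearMap.mem_ker, LinearMap.coprod_apply] at this ⊢
    rw [add_comm]; exact this⟩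
  invFun z := ⟨(z.1.2, z.1.1), by
    have := z.2
    rw [LinearMap.mem_ker, LinearMap.coprod_apply] at this ⊢
    rw [add_comm]; exact this⟩
  map_add' _ _ := rfl
  map_smul' _ _ := rfl
  left_inv _ := rfl
  right_inv _ := rfl

/-- The pullback of a map `f` and an injective map `i` is the kernel of the composite of `f` with
the projection onto the cokernel of `i`. -/
theorem nonempty_ker_coprod_equiv_ker_mkQ_comp {P E F : Type*} [AddCommGroup P] [Module R P]
    [AddCommGroup E] [Module R E] [AddCommGroup F] [Module R F]
    (i : F →ₗ[R] E) (hi : Function.Injective i) (f : P →ₗ[R] E) :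
    Nonempty (LinearMap.ker (i.coprod f) ≃ₗ[R]
      LinearMap.ker ((LinearMap.range i).mkQ ∘ₗ f)) := by
  let g : LinearMap.ker (i.coprod f) →ₗ[R] LinearMap.ker ((LinearMap.range i).mkQ ∘ₗ f) :=
    LinearMap.codRestrict _ (LinearMap.snd R F P ∘ₗ (LinearMap.ker (i.coprod f)).subtype) (by
      rintro ⟨⟨r, p⟩, h⟩
      have h' : i r + f p = 0 := h
      rw [LinearMap.mem_ker, LinearMap.comp_apply, Submodule.mkQ_apply,
        Submodule.Quotient.mk_eq_zero]
      exact ⟨-r, by rw [map_neg]; exact neg_eq_of_add_eq_zero_right h'⟩)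
  refine ⟨LinearEquiv.ofBijective g ⟨?_, ?_⟩⟩
  · rw [← LinearMap.ker_eq_bot, LinearMap.ker_eq_bot']
    rintro ⟨⟨r, p⟩, h⟩ h₀
    have h' : i r + f p = 0 := h
    have hp : p = 0 := congrArg Subtype.val h₀
    have hr : r = 0 := hi (by rw [map_zero]; simpa [hp] using h')
    subst hp hr
    rfl
  · rintro ⟨p, hp⟩
    rw [LinearMap.mem_ker, LinearMap.comp_apply, Submodule.mkQ_apply,
      Submodule.Quotient.mk_eq_zero] at hp
    obtain ⟨r, hr⟩ := hp
    exact ⟨⟨(-r, p), by rw [LinearMap.mem_ker, LinearMap.coprod_apply, map_neg, hr,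
      neg_add_cancel]⟩, rfl⟩

variable (k : Type*) [Field k] [Algebra k R]

/-- The dimension of the dual `Hom(M, R)` of a module over a `k`-algebra `R`. -/
def dualRank (R : Type u) [Ring R] [Algebra k R] (M : Type*) [AddCommGroup M] [Module R M] : ℕ :=
  Module.finrank k (M →ₗ[R] R)

theorem dualRank_congr {M N : Type*} [AddCommGroup M] [Module R M] [AddCommGroup N] [Module R N]
    (e : M ≃ₗ[R] N) : dualRank k R M = dualRank k R N := by
  refine LinearEquiv.finrank_eq (LinearEquiv.ofLinearMap (LinearMap.lcomp k R e.symm.toLinearMap)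
    (LinearMap.lcomp k R e.toLinearMap) ?_ ?_)
  · ext f x; simp
  · ext f x; simp

variable [Module.Finite k R]

instance finite_dual (M : Type*) [AddCommGroup M] [Module R M] [Module.Finite R M] :
    Module.Finite k (M →ₗ[R] R) := by
  obtain ⟨n, f, hf⟩ := Module.Finite.exists_fin' R M
  let φ : (M →ₗ[R] R) →ₗ[k] (Fin n → R) :=
    { toFun := fun g j => g (f (Pi.single j 1))
      map_add' := fun _ _ => rfl
      map_smul' := fun _ _ => rfl }
  refine Module.Finite.of_injective φ fun g g' h => ?_
  have : g ∘ₗ f = g' ∘ₗ f := LinearMap.pi_ext' fun j => LinearMap.ext_ring (congrFun h j)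
  exact LinearMap.ext fun x => by
    obtain ⟨y, rfl⟩ := hf x
    exact LinearMap.congr_fun this y

theorem dualRank_prod (M N : Type*) [AddCommGroup M] [Module R M] [AddCommGroup N] [Module R N]
    [Module.Finite R M] [Module.Finite R N] :
    dualRank k R (M × N) = dualRank k R M + dualRank k R N := by
  rw [dualRank, ← (LinearMap.coprodEquiv (M := M) (M₂ := N) (M₃ := R) (R := R) k).finrank_eq,
    Module.finrank_prod]
  rfl

/-- If the dimensions of the duals add up along `0 → R → E → coker → 0`, then `Hom(-, R)` is exact
on this sequence, and hence the sequence splits. -/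
theorem exists_retraction_of_dualRank {E : Type*} [AddCommGroup E] [Module R E]
    [Module.Finite R E] (i : R →ₗ[R] E)
    (h : dualRank k R E = dualRank k R (E ⧸ LinearMap.range i) + dualRank k R R) :
    ∃ ρ : E →ₗ[R] R, ρ ∘ₗ i = LinearMap.id := by
  let res : (E →ₗ[R] R) →ₗ[k] (R →ₗ[R] R) := LinearMap.lcomp k R i
  let inf : ((E ⧸ LinearMap.range i) →ₗ[R] R) →ₗ[k] (E →ₗ[R] R) :=
    LinearMap.lcomp k R (LinearMap.range i).mkQ
  have hker : LinearMap.ker res ≤ LinearMap.range inf := by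
    intro g hg
    have hg' : g ∘ₗ i = 0 := hg
    have hle : LinearMap.range i ≤ LinearMap.ker g := LinearMap.range_le_ker_iff.2 hg'
    exact ⟨(LinearMap.range i).liftQ g hle, Submodule.liftQ_mkQ _ g hle⟩
  have h₁ := LinearMap.finrank_range_add_finrank_ker res
  have h₂ : Module.finrank k (LinearMap.ker res) ≤ dualRank k R (E ⧸ LinearMap.range i) :=
    (Submodule.finrank_mono hker).trans (LinearMap.finrank_range_le inf)
  -- By rank-nullity, the range of the restriction map has at least the dimension of `Hom(R, R)`.
  have h₃ : LinearMap.range res = ⊤ := by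
    apply Submodule.eq_top_of_finrank_eq
    apply le_antisymm (Submodule.finrank_le _)
    unfold dualRank at h h₂
    omega
  exact LinearMap.range_eq_top.1 h₃ LinearMap.id

variable [IsArtinianRing R]

/-- The alternating sum of the dimensions of `Hom(-, R)` along `0 → Ω(M) → P(M) → M → 0`, that is,
the dimension of `Ext¹(M, R)`. -/
def dualEuler (M : FGModuleCat.{u} R) : ℤ :=
  dualRank k R M - dualRank k R (projectiveCover M) + dualRank k R (syzygy M)

/-- Any presentation by a projective module computes the Euler characteristic. -/
theorem dualEuler_eq {P : Type u} [AddCommGroup P] [Module R P] [Module.Finite R P]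
    [Module.Projective R P] {M : FGModuleCat.{u} R} (f : P →ₗ[R] M)
    (hf : Function.Surjective f) :
    dualEuler k M = dualRank k R M - dualRank k R P + dualRank k R (LinearMap.ker f) := by
  have h₀ := isProjectiveCover_projectiveCoverMap M
  have := h₀.projective
  obtain ⟨e⟩ := nonempty_ker_coprod_equiv (projectiveCoverMap M) f hf
  obtain ⟨e'⟩ := nonempty_ker_coprod_equiv f (projectiveCoverMap M) h₀.surjective
  have h₁ := dualRank_congr k (e'.symm ≪≫ₗ kerCoprodSwap f (projectiveCoverMap M) ≪≫ₗ e)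
  rw [dualRank_prod, dualRank_prod] at h₁
  have h₂ : dualRank k R (syzygy M) = dualRank k R (LinearMap.ker (projectiveCoverMap M)) := rfl
  rw [dualEuler, h₂]
  omega

theorem dualEuler_projective (P : FGModuleCat.{u} R) (hP : Module.Projective R P) :
    dualEuler k P = 0 := by
  rw [dualEuler_eq k (LinearMap.id : P →ₗ[R] P) Function.surjective_id]
  have : Subsingleton (LinearMap.ker (LinearMap.id : P →ₗ[R] P)) := by
    rw [LinearMap.ker_id]; infer_instance
  have h : dualRank k R (LinearMap.ker (LinearMap.id : P →ₗ[R] P)) = 0 :=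
    Module.finrank_zero_of_subsingleton
  rw [h]
  simp

theorem dualEuler_add {M M' M'' : FGModuleCat.{u} R} (e : M ≃ₗ[R] M' × M'') :
    dualEuler k M = dualEuler k M' + dualEuler k M'' := by
  have h' := isProjectiveCover_projectiveCoverMap M'
  have h'' := isProjectiveCover_projectiveCoverMap M''
  have p' := h'.projective
  have p'' := h''.projective
  let f : (projectiveCover M' × projectiveCover M'') →ₗ[R] M :=
    e.symm.toLinearMap ∘ₗ (projectiveCoverMap M').prodMap (projectiveCoverMap M'')
  have hf : Function.Surjective f :=
    e.symm.surjective.comp (Function.Surjective.prodMap h'.surjective h''.surjective)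
  have hker : ∀ z : projectiveCover M' × projectiveCover M'', z ∈ LinearMap.ker f ↔
      projectiveCoverMap M' z.1 = 0 ∧ projectiveCoverMap M'' z.2 = 0 := by
    intro z
    change e.symm (projectiveCoverMap M' z.1, projectiveCoverMap M'' z.2) = 0 ↔ _
    rw [LinearEquiv.map_eq_zero_iff, Prod.mk_eq_zero]
  let e₀ : LinearMap.ker f ≃ₗ[R]
      LinearMap.ker (projectiveCoverMap M') × LinearMap.ker (projectiveCoverMap M'') :=
    { toFun := fun z => (⟨z.1.1, ((hker z.1).1 z.2).1⟩, ⟨z.1.2, ((hker z.1).1 z.2).2⟩)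
      invFun := fun w => ⟨(w.1.1, w.2.1), (hker _).2 ⟨w.1.2, w.2.2⟩⟩
      map_add' := fun _ _ => rfl
      map_smul' := fun _ _ => rfl
      left_inv := fun _ => rfl
      right_inv := fun _ => rfl }
  have h₁ : dualRank k R (LinearMap.ker f) =
      dualRank k R (syzygy M') + dualRank k R (syzygy M'') := by
    rw [dualRank_congr k e₀, dualRank_prod]
    rfl
  rw [dualEuler_eq k f hf, h₁, dualRank_prod, dualRank_congr k e, dualRank_prod, dualEuler,
    dualEuler]
  push_cast
  ring

/-- The Euler characteristic as a homomorphism on `K₀`. -/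
def dualEulerHom : K₀ R →+ ℤ :=
  QuotientAddGroup.lift (AddSubgroup.closure (relations R))
    (FreeAbelianGroup.lift fun M => dualEuler k M) (by
      rw [AddSubgroup.closure_le]
      rintro x (⟨M, M', M'', ⟨e⟩, rfl⟩ | ⟨P, hP, rfl⟩)
      · simp [dualEuler_add k e]
      · simp [dualEuler_projective k P hP])

theorem dualEulerHom_cls (M : FGModuleCat.{u} R) : dualEulerHom k (cls M) = dualEuler k M := by
  simp [dualEulerHom, cls]

end Dual

/-! ### Vanishing `φ`-dimension and self-injectivity -/

section SelfInjective

variable {R : Type u} [Ring R] [IsArtinianRing R]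

/-- If `φdim R = 0`, then `Ω̄` is injective on `⟨add M⟩` for every `M`. -/
theorem injOn_syzygyHom_of_phiDim_eq_zero (h : phiDim R = 0) (M : FGModuleCat.{u} R) :
    Set.InjOn (syzygyHom R) (addSubgroup M : Set (K₀ R)) := by
  have h₁ : phi M = 0 := by
    rw [phiDim, ← bot_eq_zero, iSup_eq_bot] at h
    exact h M
  by_contra hM
  -- Otherwise every `l` in the set defining `φ(M)` is positive, and `φ(M) ≥ 1`.
  have h₂ : (1 : ℕ∞) ≤ phi M := by
    refine le_iInf₂ fun l hl => ?_
    rcases Nat.eq_zero_or_pos l with rfl | hl'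
    · exact absurd (by simpa using hl 0) hM
    · exact_mod_cast hl'
  rw [h₁] at h₂
  exact absurd h₂ (by simp)

/-- The class of a direct summand of `M` lies in `⟨add M⟩`, by induction on the length. -/
theorem cls_mem_addSubgroup {M : FGModuleCat.{u} R} (n : ℕ) :
    ∀ N L : FGModuleCat.{u} R, Module.length R N ≤ n → Nonempty (M ≃ₗ[R] N × L) →
      cls N ∈ addSubgroup M := by
  induction n using Nat.strong_induction_on with
  | _ n ih =>
    rintro N L hn ⟨e⟩
    rcases subsingleton_or_nontrivial N with hs | hs
    · rw [cls_projective N Module.Projective.of_free]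
      exact zero_mem _
    by_cases hN : IsIndecomposable R N
    · exact AddSubgroup.subset_closure ⟨N, L, hN, ⟨e⟩, rfl⟩
    have : ∃ A B : Submodule R N, IsCompl A B ∧ A ≠ ⊥ ∧ B ≠ ⊥ := by
      by_contra! hcon
      exact hN ⟨hs, fun A B hAB => or_iff_not_imp_left.2 (hcon A B hAB)⟩
    obtain ⟨A, B, hAB, hA, hB⟩ := this
    let eN : N ≃ₗ[R] A × B := (Submodule.prodEquivOfIsCompl A B hAB).symm
    have hlen : Module.length R N = Module.length R A + Module.length R B := by
      rw [eN.length_eq, Module.length_prod]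
    have hA' : Nontrivial A := Submodule.nontrivial_iff_ne_bot.2 hA
    have hB' : Nontrivial B := Submodule.nontrivial_iff_ne_bot.2 hB
    obtain ⟨a, ha⟩ := ENat.ne_top_iff_exists.1 (Module.length_ne_top (R := R) (M := A))
    obtain ⟨b, hb⟩ := ENat.ne_top_iff_exists.1 (Module.length_ne_top (R := R) (M := B))
    have ha₀ := Module.length_pos (R := R) (M := A)
    have hb₀ := Module.length_pos (R := R) (M := B)
    rw [hlen, ← ha, ← hb] at hn
    rw [← ha] at ha₀
    rw [← hb] at hb₀
    norm_cast at hn ha₀ hb₀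
    have h₁ := ih a (by omega) (FGModuleCat.of R A) (FGModuleCat.of R (B × L)) ha.ge
      ⟨e ≪≫ₗ (eN.prodCongr (LinearEquiv.refl R L)) ≪≫ₗ LinearEquiv.prodAssoc R A B L⟩
    have h₂ := ih b (by omega) (FGModuleCat.of R B) (FGModuleCat.of R (A × L)) hb.ge
      ⟨e ≪≫ₗ ((eN ≪≫ₗ LinearEquiv.prodComm R A B).prodCongr (LinearEquiv.refl R L)) ≪≫ₗ
        LinearEquiv.prodAssoc R B A L⟩
    rw [cls_eq_add (M := N) (M' := FGModuleCat.of R A) (M'' := FGModuleCat.of R B) eN]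
    exact add_mem h₁ h₂

/-- If `φdim R = 0`, then the class of a module is determined by the class of its syzygy. -/
theorem cls_eq_of_cls_syzygy_eq (h : phiDim R = 0) {M N : FGModuleCat.{u} R}
    (hMN : cls (syzygy M) = cls (syzygy N)) : cls M = cls N := by
  let X : FGModuleCat.{u} R := FGModuleCat.of R (M × N)
  obtain ⟨m, hm⟩ := ENat.ne_top_iff_exists.1 (Module.length_ne_top (R := R) (M := M))
  obtain ⟨n, hn⟩ := ENat.ne_top_iff_exists.1 (Module.length_ne_top (R := R) (M := N))
  refine injOn_syzygyHom_of_phiDim_eq_zero h X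
    (cls_mem_addSubgroup m M N hm.ge ⟨LinearEquiv.refl R (M × N)⟩)
    (cls_mem_addSubgroup n N M hn.ge ⟨LinearEquiv.prodComm R M N⟩) ?_
  rw [syzygyHom_cls, syzygyHom_cls, hMN]

/-- If `φdim R = 0`, then every embedding of `R` into a finitely generated module splits.
The module `E` and the cokernel of `R → E` have the same syzygy up to the projective summand `R`,
hence the same class in `K₀`, hence the same Euler characteristic; so the dimensions of the duals
add up along `0 → R → E → coker → 0`. -/
theorem exists_retraction_of_phiDim_eq_zero (k : Type*) [Field k] [Algebra k R]
    [Module.Finite k R] (h : phiDim R = 0) {E : Type u} [AddCommGroup E] [Module R E]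
    [Module.Finite R E] (i : R →ₗ[R] E) (hi : Function.Injective i) :
    ∃ ρ : E →ₗ[R] R, ρ ∘ₗ i = LinearMap.id := by
  apply exists_retraction_of_dualRank k i
  let M : FGModuleCat.{u} R := FGModuleCat.of R E
  let C : FGModuleCat.{u} R := FGModuleCat.of R (E ⧸ LinearMap.range i)
  have h₀ := isProjectiveCover_projectiveCoverMap M
  have hP := h₀.projective
  let f : projectiveCover M →ₗ[R] E := projectiveCoverMap M
  let g : projectiveCover M →ₗ[R] C := (LinearMap.range i).mkQ ∘ₗ f
  have hg : Function.Surjective g :=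
    (Submodule.mkQ_surjective _).comp h₀.surjective
  obtain ⟨e₁⟩ := nonempty_ker_coprod_equiv_ker_mkQ_comp i hi f
  obtain ⟨e₂⟩ := nonempty_ker_coprod_equiv i f h₀.surjective
  let e : LinearMap.ker g ≃ₗ[R] LinearMap.ker f × R := e₁.symm ≪≫ₗ e₂
  have hcls : cls (syzygy C) = cls (syzygy M) := by
    rw [cls_syzygy_eq g hP hg, cls_eq_add (M := FGModuleCat.of R (LinearMap.ker g))
      (M' := syzygy M) (M'' := FGModuleCat.of R R) e,
      cls_projective (FGModuleCat.of R R) (inferInstanceAs (Module.Projective R R)), add_zero]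
  have h₁ : dualEuler k C = dualEuler k M := by
    rw [← dualEulerHom_cls, ← dualEulerHom_cls, cls_eq_of_cls_syzygy_eq h hcls]
  rw [dualEuler_eq k g hg, dualEuler_eq k (M := M) f h₀.surjective, dualRank_congr k e,
    dualRank_prod] at h₁
  change (dualRank k R (E ⧸ LinearMap.range i) : ℤ) - _ + _ = (dualRank k R E : ℤ) - _ + _ at h₁
  push_cast at h₁
  omega

/-- A consequence of self-injectivity: the homomorphism `R x → R y`, `r x ↦ r y`, is right
multiplication by an element of `R`. The splitting is applied to the pushout `(R × R) / R (x, -y)`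
of `R ← R x → R`. -/
theorem exists_eq_mul_of_phiDim_eq_zero (k : Type*) [Field k] [Algebra k R]
    [Module.Finite k R] (h : phiDim R = 0) (x y : R) (hxy : ∀ r : R, r * x = 0 → r * y = 0) :
    ∃ c : R, y = x * c := by
  let N : Submodule R (R × R) := Submodule.span R {(x, -y)}
  let i : R →ₗ[R] (R × R) ⧸ N := N.mkQ ∘ₗ LinearMap.inr R R R
  have hi : Function.Injective i := by
    rw [← LinearMap.ker_eq_bot, LinearMap.ker_eq_bot']
    intro r hr
    have hr' : ((0 : R), r) ∈ N := (Submodule.Quotient.mk_eq_zero N).1 hr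
    obtain ⟨s, hs⟩ := Submodule.mem_span_singleton.1 hr'
    have hs₁ : s * x = 0 := congrArg Prod.fst hs
    have hs₂ : s * -y = r := congrArg Prod.snd hs
    rw [← hs₂, mul_neg, hxy s hs₁, neg_zero]
  obtain ⟨ρ, hρ⟩ := exists_retraction_of_phiDim_eq_zero k h i hi
  refine ⟨ρ (N.mkQ (1, 0)), ?_⟩
  have h₁ : ρ (N.mkQ (0, y)) = y := LinearMap.congr_fun hρ y
  have h₂ : N.mkQ (x, 0) = N.mkQ (0, y) := by
    rw [← sub_eq_zero, ← map_sub, Submodule.mkQ_apply, Submodule.Quotient.mk_eq_zero]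
    exact Submodule.subset_span (by simp)
  rw [← smul_eq_mul, ← map_smul, ← map_smul, ← h₁, ← h₂]
  simp

end SelfInjective

end

end IgusaTodorov

namespace PathAlgebra

noncomputable section

variable (k : Type u) {V : Type v} [Field k] [Quiver.{w} V]

/-! ### Subspaces spanned by paths -/

/-- The subspace of the path algebra spanned by a set of paths. -/
def pathSpan (S : Set (QuiverPath V)) : Submodule k (PathAlgebra k V) :=
  Submodule.span k (ofPath k '' S)

variable {k}

theorem ofPath_mem_pathSpan {S : Set (QuiverPath V)} {x : QuiverPath V} (hx : x ∈ S) :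
    ofPath k x ∈ pathSpan k S :=
  Submodule.subset_span ⟨x, hx, rfl⟩

theorem mem_pathSpan_iff {S : Set (QuiverPath V)} {f : PathAlgebra k V} :
    f ∈ pathSpan k S ↔ ∀ x, (basis k).coord x f ≠ 0 → x ∈ S := by
  have h : pathSpan k S = Submodule.span k (basis k '' S) := rfl
  rw [h, Module.Basis.mem_span_image]
  constructor
  · intro h x hx
    exact h (Finsupp.mem_support_iff.2 hx)
  · intro h x hx
    exact h x (Finsupp.mem_support_iff.1 hx)

theorem coord_ofPath_self (x : QuiverPath V) : (basis k).coord x (ofPath k x) = 1 := by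
  rw [← basis_apply, Module.Basis.coord_apply, Module.Basis.repr_self, Finsupp.single_eq_same]

theorem coord_ofPath_of_ne {x y : QuiverPath V} (h : x ≠ y) :
    (basis k).coord x (ofPath k y) = 0 := by
  rw [← basis_apply, Module.Basis.coord_apply, Module.Basis.repr_self,
    Finsupp.single_eq_of_ne h]

theorem ofPath_mem_pathSpan_iff {S : Set (QuiverPath V)} {x : QuiverPath V} :
    ofPath k x ∈ pathSpan k S ↔ x ∈ S := by
  refine ⟨fun h => mem_pathSpan_iff.1 h x ?_, ofPath_mem_pathSpan⟩
  rw [coord_ofPath_self]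
  exact one_ne_zero

theorem mul_mem_pathSpan {S T U : Set (QuiverPath V)}
    (h : ∀ {a b c : V} (p : Quiver.Path a b) (q : Quiver.Path b c),
      ⟨a, b, p⟩ ∈ S → ⟨b, c, q⟩ ∈ T → ⟨a, c, p.comp q⟩ ∈ U)
    {f g : PathAlgebra k V} (hf : f ∈ pathSpan k S) (hg : g ∈ pathSpan k T) :
    f * g ∈ pathSpan k U := by
  have h₁ : Submodule.map₂ (mulLin k) (pathSpan k S) (pathSpan k T) ≤ pathSpan k U := by
    rw [pathSpan, pathSpan, Submodule.map₂_span_span, Submodule.span_le]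
    rintro _ ⟨_, ⟨⟨a, b, p⟩, hp, rfl⟩, _, ⟨⟨b', c, q⟩, hq, rfl⟩, rfl⟩
    change mulLin k (ofPath k _) (ofPath k _) ∈ pathSpan k U
    rw [mulLin_ofPath]
    by_cases hb : b = b'
    · subst hb
      rw [mulPath_comp]
      exact ofPath_mem_pathSpan (h p q hp hq)
    · rw [mulPath_of_ne k (x := ⟨a, b, p⟩) (y := ⟨b', c, q⟩) hb]
      exact zero_mem _
  exact h₁ (Submodule.apply_mem_map₂ _ hf hg)

theorem mem_pathSpan_univ (f : PathAlgebra k V) : f ∈ pathSpan k Set.univ :=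
  mem_pathSpan_iff.2 fun _ _ => Set.mem_univ _

variable [Fintype V]

/-- A set of paths closed under prolongation at both ends spans a two-sided ideal. -/
theorem span_le_pathSpan {G : Set (PathAlgebra k V)} {T : Set (QuiverPath V)}
    (hG : G ⊆ pathSpan k T)
    (hT₁ : ∀ {a b c : V} (p : Quiver.Path a b) (q : Quiver.Path b c),
      ⟨a, b, p⟩ ∈ T → ⟨a, c, p.comp q⟩ ∈ T)
    (hT₂ : ∀ {a b c : V} (p : Quiver.Path a b) (q : Quiver.Path b c),
      ⟨b, c, q⟩ ∈ T → ⟨a, c, p.comp q⟩ ∈ T)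
    {f : PathAlgebra k V} (hf : f ∈ TwoSidedIdeal.span G) : f ∈ pathSpan k T := by
  let K : TwoSidedIdeal (PathAlgebra k V) := TwoSidedIdeal.mk' (pathSpan k T)
    (zero_mem _) (fun h h' => add_mem h h') (fun h => neg_mem h)
    (fun h => mul_mem_pathSpan (fun p q _ h => hT₂ p q h) (mem_pathSpan_univ _) h)
    (fun h => mul_mem_pathSpan (fun p q h _ => hT₁ p q h) h (mem_pathSpan_univ _))
  have hK : ∀ x, x ∈ K ↔ x ∈ pathSpan k T := fun x => TwoSidedIdeal.mem_mk' _ _ _ _ _ _ x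
  have : TwoSidedIdeal.span G ≤ K := TwoSidedIdeal.span_le.2 fun x hx => (hK x).2 (hG hx)
  exact (hK f).1 (this hf)

theorem pathSpan_le_of_forall_mem {I : Ideal (PathAlgebra k V)} {S : Set (QuiverPath V)}
    (hS : ∀ x ∈ S, ofPath k x ∈ I) {f : PathAlgebra k V} (hf : f ∈ pathSpan k S) : f ∈ I := by
  have : pathSpan k S ≤ I.restrictScalars k := by
    rw [pathSpan, Submodule.span_le]
    rintro _ ⟨x, hx, rfl⟩
    exact hS x hx
  exact this hf

theorem ofPath_comp_mem_left {I : Ideal (PathAlgebra k V)} [I.IsTwoSided] {a b c : V}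
    (p : Quiver.Path a b) (q : Quiver.Path b c) (h : ofPath k ⟨a, b, p⟩ ∈ I) :
    ofPath k ⟨a, c, p.comp q⟩ ∈ I := by
  rw [← mulPath_comp, ← ofPath_mul_ofPath]
  exact I.mul_mem_right _ h

theorem ofPath_comp_mem_right {I : Ideal (PathAlgebra k V)} {a b c : V}
    (p : Quiver.Path a b) (q : Quiver.Path b c) (h : ofPath k ⟨b, c, q⟩ ∈ I) :
    ofPath k ⟨a, c, p.comp q⟩ ∈ I := by
  rw [← mulPath_comp, ← ofPath_mul_ofPath]
  exact I.mul_mem_left _ h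

/-- A monomial ideal is spanned by the paths it contains. -/
theorem IsMonomial.mem_iff {I : Ideal (PathAlgebra k V)} [I.IsTwoSided] (hI : IsMonomial I)
    {f : PathAlgebra k V} : f ∈ I ↔ f ∈ pathSpan k {x | ofPath k x ∈ I} := by
  refine ⟨fun hf => ?_, pathSpan_le_of_forall_mem fun _ h => h⟩
  obtain ⟨S, hS⟩ := hI
  refine span_le_pathSpan (G := ofPath k '' S) ?_ (fun p q => ofPath_comp_mem_left p q)
    (fun p q => ofPath_comp_mem_right p q) ?_
  · rintro _ ⟨x, hx, rfl⟩
    refine ofPath_mem_pathSpan ?_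
    rw [Set.mem_ofPred_eq, hS]
    exact TwoSidedIdeal.mem_asIdeal.2 (TwoSidedIdeal.subset_span ⟨x, hx, rfl⟩)
  · rw [hS] at hf
    exact TwoSidedIdeal.mem_asIdeal.1 hf

/-- The `n`-th power of the arrow ideal is spanned by the paths of length at least `n`. -/
theorem mem_arrowIdeal_pow_iff (n : ℕ) {f : PathAlgebra k V} :
    f ∈ arrowIdeal k V ^ n ↔ f ∈ pathSpan k {x : QuiverPath V | n ≤ x.2.2.length} := by
  refine ⟨?_, pathSpan_le_of_forall_mem fun x hx => ofPath_mem_pow n x.2.2 hx⟩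
  induction n generalizing f with
  | zero =>
    intro _
    exact mem_pathSpan_iff.2 fun _ _ => Nat.zero_le _
  | succ n ih =>
    have h₁ : ∀ g ∈ arrowIdeal k V, g ∈ pathSpan k {x : QuiverPath V | 1 ≤ x.2.2.length} := by
      intro g hg
      refine span_le_pathSpan ?_ ?_ ?_ (TwoSidedIdeal.mem_asIdeal.1 hg)
      · rintro _ ⟨a, b, e, rfl⟩
        exact ofPath_mem_pathSpan (Set.mem_ofPred_eq.symm ▸ le_rfl)
      · intro a b c p q h
        simp only [Set.mem_ofPred_eq, Quiver.Path.length_comp] at *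
        omega
      · intro a b c p q h
        simp only [Set.mem_ofPred_eq, Quiver.Path.length_comp] at *
        omega
    rw [Ideal.IsTwoSided.pow_add, Submodule.pow_one]
    intro hf
    refine Submodule.mul_induction_on hf (fun x hx y hy => ?_) fun x y hx hy => add_mem hx hy
    refine mul_mem_pathSpan ?_ (ih hx) (h₁ y hy)
    intro a b c p q hp hq
    simp only [Set.mem_ofPred_eq, Quiver.Path.length_comp] at *
    omega

/-! ### Maximal nonzero paths -/

/-- A path `p` is right-maximal for a set `Z` of paths (thought of as the paths that are zero in a
monomial algebra) if `p` is not in `Z`, but all prolongations of `p` by an arrow at its end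
are. -/
def _root_.QuiverPath.IsRightMaximal {W : Type v} [Quiver.{w} W] (Z : Set (QuiverPath W))
    {a b : W} (p : Quiver.Path a b) : Prop :=
  ⟨a, b, p⟩ ∉ Z ∧ ∀ (c : W) (e : b ⟶ c), ⟨a, c, p.cons e⟩ ∈ Z

open QuiverPath

section Ideal

variable {I : Ideal (PathAlgebra k V)} [I.IsTwoSided]

theorem ofPath_comp_mem_of_isRightMaximal {a b : V} {p : Quiver.Path a b}
    (hp : IsRightMaximal {x | ofPath k x ∈ I} p) {c : V} (q : Quiver.Path b c)
    (hq : q.length ≠ 0) : ofPath k ⟨a, c, p.comp q⟩ ∈ I := by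
  induction q with
  | nil => exact absurd rfl hq
  | cons q e ih =>
    rw [Quiver.Path.comp_cons]
    cases q with
    | nil => exact hp.2 _ e
    | cons q e' =>
      rw [← Quiver.Path.comp_toPath_eq_cons]
      exact ofPath_comp_mem_left _ _ (ih (by simp))

/-- Right multiplication of a right-maximal path `p` by `f` is, modulo `I`, multiplication by the
coefficient in `f` of the trivial path at the end of `p`. -/
theorem ofPath_mul_sub_mem_of_isRightMaximal {a b : V} {p : Quiver.Path a b}
    (hp : IsRightMaximal {x | ofPath k x ∈ I} p) (f : PathAlgebra k V) :
    ofPath k ⟨a, b, p⟩ * f -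
      (basis k).coord ⟨b, b, Quiver.Path.nil⟩ f • ofPath k ⟨a, b, p⟩ ∈ I := by
  refine Submodule.span_induction
    (p := fun f _ => ofPath k ⟨a, b, p⟩ * f -
      (basis k).coord ⟨b, b, Quiver.Path.nil⟩ f • ofPath k ⟨a, b, p⟩ ∈ I)
    ?_ ?_ ?_ ?_ ((basis k).mem_span f)
  · rintro _ ⟨⟨c, d, q⟩, rfl⟩
    rw [basis_apply, ofPath_mul_ofPath]
    by_cases hc : b = c
    · subst hc
      rw [mulPath_comp]
      by_cases hq : q.length = 0
      · obtain rfl := q.eq_of_length_zero hq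
        obtain rfl := q.eq_nil_of_length_zero hq
        rw [coord_ofPath_self, one_smul, Quiver.Path.comp_nil, sub_self]
        exact zero_mem _
      · rw [coord_ofPath_of_ne, zero_smul, sub_zero]
        · exact ofPath_comp_mem_of_isRightMaximal hp q hq
        · intro h
          apply hq
          have := congrArg (fun x : QuiverPath V => x.2.2.length) h
          exact this.symm
    · rw [mulPath_of_ne k (x := ⟨a, b, p⟩) (y := ⟨c, d, q⟩) hc, coord_ofPath_of_ne, zero_smul,
        sub_zero]
      · exact zero_mem _
      · intro h
        exact hc (congrArg Sigma.fst h)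
  · simp
  · intro x y _ _ hx hy
    have := add_mem hx hy
    rw [map_add, add_smul, mul_add]
    convert this using 1
    abel
  · intro t x _ hx
    have := (I.restrictScalars k).smul_mem t hx
    rw [smul_sub] at this
    rw [map_smul, mul_smul_comm, smul_assoc]
    exact this

/-- If the class of `q` modulo a monomial ideal is a left multiple of the class of `p`, and `q` is
nonzero, then `p` is a final segment of `q`. -/
theorem exists_eq_comp_of_sub_mul_mem (hI : IsMonomial I) {x : QuiverPath V} {b c : V}
    {p : Quiver.Path b c} {f : PathAlgebra k V} (hx : ofPath k x ∉ I)
    (h : ofPath k x - f * ofPath k ⟨b, c, p⟩ ∈ I) :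
    ∃ (a : V) (s : Quiver.Path a b), x = ⟨a, c, s.comp p⟩ := by
  have h₁ : f * ofPath k ⟨b, c, p⟩ ∈
      pathSpan k {y | ∃ (a : V) (s : Quiver.Path a b), y = ⟨a, c, s.comp p⟩} := by
    refine mul_mem_pathSpan ?_ (mem_pathSpan_univ f)
      (ofPath_mem_pathSpan (Set.mem_singleton (⟨b, c, p⟩ : QuiverPath V)))
    rintro a b' c' s q - hq
    obtain ⟨rfl, hq⟩ := Sigma.mk.inj_iff.1 (Set.mem_singleton_iff.1 hq)
    obtain ⟨rfl, hq⟩ := Sigma.mk.inj_iff.1 (eq_of_heq hq)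
    obtain rfl := eq_of_heq hq
    exact ⟨a, s, rfl⟩
  apply mem_pathSpan_iff.1 h₁ x
  intro h₀
  -- Otherwise `x` occurs with coefficient one in an element of the monomial ideal `I`.
  apply hx
  apply mem_pathSpan_iff.1 (hI.mem_iff.1 h) x
  rw [map_sub, h₀, sub_zero, coord_ofPath_self]
  exact one_ne_zero

end Ideal

open MulOpposite in
/-- In a monomial algebra of vanishing `φ`-dimension, right-maximal paths `p` and `q` with the same
end coincide: they generate isomorphic simple right modules, so by self-injectivity each is
a left multiple of the other. -/
theorem eq_of_isRightMaximal [∀ a b : V, Finite (a ⟶ b)]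
    {I : Ideal (PathAlgebra k V)} [IsAdmissible I] (hI : IsMonomial I)
    (hphi : IgusaTodorov.phiDim (PathAlgebra k V ⧸ I)ᵐᵒᵖ = 0) {a b c : V}
    {p : Quiver.Path a c} {q : Quiver.Path b c}
    (hp : IsRightMaximal {x | ofPath k x ∈ I} p) (hq : IsRightMaximal {x | ofPath k x ∈ I} q) :
    (⟨a, c, p⟩ : QuiverPath V) = ⟨b, c, q⟩ := by
  have : Module.Finite k (PathAlgebra k V ⧸ I)ᵐᵒᵖ :=
    Module.Finite.equiv (opLinearEquiv k (M := PathAlgebra k V ⧸ I))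
  have main : ∀ {a b : V} {p : Quiver.Path a c} {q : Quiver.Path b c},
      IsRightMaximal {x | ofPath k x ∈ I} p → IsRightMaximal {x | ofPath k x ∈ I} q →
      ∃ (d : V) (s : Quiver.Path d a), (⟨b, c, q⟩ : QuiverPath V) = ⟨d, c, s.comp p⟩ := by
    intro a b p q hp hq
    obtain ⟨z, hz⟩ := IgusaTodorov.exists_eq_mul_of_phiDim_eq_zero k hphi
      (op (Ideal.Quotient.mk I (ofPath k ⟨a, c, p⟩)))
      (op (Ideal.Quotient.mk I (ofPath k ⟨b, c, q⟩))) (by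
        intro r hr
        obtain ⟨f, hf⟩ := Ideal.Quotient.mk_surjective r.unop
        obtain rfl : op (Ideal.Quotient.mk I f) = r := by rw [hf, op_unop]
        rw [← op_mul, op_eq_zero_iff, ← map_mul, Ideal.Quotient.eq_zero_iff_mem] at hr ⊢
        have h₁ := sub_mem hr (ofPath_mul_sub_mem_of_isRightMaximal hp f)
        rw [sub_sub_cancel] at h₁
        have h₀ : (basis k).coord ⟨c, c, Quiver.Path.nil⟩ f = 0 := by
          by_contra hne
          apply hp.1
          have := (I.restrictScalars k).smul_mem
            ((basis k).coord ⟨c, c, Quiver.Path.nil⟩ f)⁻¹ h₁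
          rwa [smul_smul, inv_mul_cancel₀ hne, one_smul] at this
        have h₂ := ofPath_mul_sub_mem_of_isRightMaximal hq f
        rwa [h₀, zero_smul, sub_zero] at h₂)
    obtain ⟨f, hf⟩ := Ideal.Quotient.mk_surjective z.unop
    obtain rfl : op (Ideal.Quotient.mk I f) = z := by rw [hf, op_unop]
    rw [← op_mul, op_inj, ← map_mul, Ideal.Quotient.mk_eq_mk_iff_sub_mem] at hz
    exact exists_eq_comp_of_sub_mul_mem hI hq.1 hz
  -- Each of the two paths is a final segment of the other, so their lengths agree.
  obtain ⟨d, s, hs⟩ := main hp hq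
  obtain ⟨d', s', hs'⟩ := main hq hp
  have h₁ := congrArg (fun x : QuiverPath V => x.2.2.length) hs
  have h₂ := congrArg (fun x : QuiverPath V => x.2.2.length) hs'
  simp only [Quiver.Path.length_comp] at h₁ h₂
  have h₃ : s.length = 0 := by omega
  obtain rfl := s.eq_of_length_zero h₃
  obtain rfl := s.eq_nil_of_length_zero h₃
  rw [hs, Quiver.Path.nil_comp]

end

end PathAlgebra

/-! ### Finite quivers with relations whose maximal nonzero paths are determined by their ends -/

section Combinatorics

open QuiverPath

variable {V : Type v} [Quiver.{w} V]

/-- A property of vertices that is invariant along arrows is constant on a connected quiver. -/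
theorem QuiverConnected.iff_of_forall_arrow (hconn : QuiverConnected V) {P : V → Prop}
    (h : ∀ a b : V, (a ⟶ b) → (P a ↔ P b)) (a b : V) : P a ↔ P b := by
  have := hconn.2
  obtain ⟨p⟩ := (Quiver.WeaklyConnectedComponent.eq a b).1 (Subsingleton.elim _ _)
  change Quiver.Path (V := Quiver.Symmetrify V) a b at p
  induction p with
  | nil => rfl
  | cons p e ih =>
    rcases e with e | e
    · exact ih.trans (h _ _ e)
    · exact ih.trans (h _ _ e).symm

theorem Quiver.Path.exists_comp_of_le_length {a b : V} (p : Quiver.Path a b) {n : ℕ}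
    (hn : n ≤ p.length) :
    ∃ (c : V) (q : Quiver.Path a c) (r : Quiver.Path c b), p = q.comp r ∧ q.length = n := by
  induction p with
  | nil => exact ⟨_, .nil, .nil, rfl, (Nat.le_zero.1 hn).symm⟩
  | @cons b c p e ih =>
    rcases hn.eq_or_lt with rfl | hn
    · exact ⟨_, p.cons e, .nil, rfl, rfl⟩
    · obtain ⟨d, q, r, rfl, hq⟩ := ih (by simpa using Nat.lt_succ_iff.1 hn)
      exact ⟨d, q, r.cons e, rfl, hq⟩

/-- If every vertex has at most one outgoing arrow, then a path is determined by its start and its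
length. -/
theorem Quiver.Path.sigma_eq_of_length_eq (h : ∀ a : V, Subsingleton (Σ b, a ⟶ b)) {a b c : V}
    (p : Quiver.Path a b) (q : Quiver.Path a c) (hpq : p.length = q.length) :
    (⟨b, p⟩ : Σ b, Quiver.Path a b) = ⟨c, q⟩ := by
  induction p generalizing c with
  | nil =>
    cases q with
    | nil => rfl
    | cons q e => simp at hpq
  | cons p e ih =>
    cases q with
    | nil => simp at hpq
    | cons q e' =>
      obtain ⟨rfl, h₁⟩ := Sigma.mk.inj_iff.1 (ih q (by simpa using hpq))
      obtain rfl := eq_of_heq h₁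
      obtain ⟨rfl, h₂⟩ := Sigma.mk.inj_iff.1 ((h _).elim ⟨_, e⟩ ⟨_, e'⟩)
      obtain rfl := eq_of_heq h₂
      rfl

theorem Quiver.Path.sigma_eq_of_comp_eq {a b b' c : V} {p : Quiver.Path a b}
    {p' : Quiver.Path a b'} (q : Quiver.Path b c) (q' : Quiver.Path b' c)
    (h : p.comp q = p'.comp q') (hp : p.length = p'.length) :
    (⟨b, p⟩ : Σ b, Quiver.Path a b) = ⟨b', p'⟩ := by
  induction q with
  | nil =>
    have hl := congrArg Quiver.Path.length h
    simp only [Quiver.Path.length_comp, Quiver.Path.length_nil] at hl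
    have h₀ : q'.length = 0 := by omega
    obtain rfl := q'.eq_of_length_zero h₀
    obtain rfl := q'.eq_nil_of_length_zero h₀
    simpa using h
  | cons q e ih =>
    cases q' with
    | nil =>
      have hl := congrArg Quiver.Path.length h
      simp only [Quiver.Path.length_comp, Quiver.Path.length_nil, Quiver.Path.length_cons] at hl
      omega
    | cons q' e' =>
      rw [Quiver.Path.comp_cons, Quiver.Path.comp_cons] at h
      obtain rfl := Quiver.Path.obj_eq_of_cons_eq_cons h
      exact ih q' (eq_of_heq (Quiver.Path.heq_of_cons_eq_cons h))

/-- The properties of the set `Z` of zero paths of a self-injective monomial algebra on which the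
combinatorial part of the argument rests: `Z` is closed under prolongation at both ends, it contains
all sufficiently long paths and no path of length at most one, and a path that is right-maximal for
`Z` is determined by its end. -/
structure IsSelfInjectiveRelation (Z : Set (QuiverPath V)) : Prop where
  comp_left : ∀ {a b c : V} (p : Quiver.Path a b) (q : Quiver.Path b c),
    ⟨a, b, p⟩ ∈ Z → ⟨a, c, p.comp q⟩ ∈ Z
  comp_right : ∀ {a b c : V} (p : Quiver.Path a b) (q : Quiver.Path b c),
    ⟨b, c, q⟩ ∈ Z → ⟨a, c, p.comp q⟩ ∈ Z
  two_le_length : ∀ {a b : V} (p : Quiver.Path a b), ⟨a, b, p⟩ ∈ Z → 2 ≤ p.length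
  exists_bound : ∃ n : ℕ, ∀ {a b : V} (p : Quiver.Path a b), n ≤ p.length → ⟨a, b, p⟩ ∈ Z
  eq_of_isRightMaximal : ∀ {a b c : V} (p : Quiver.Path a c) (q : Quiver.Path b c),
    IsRightMaximal Z p → IsRightMaximal Z q → (⟨a, c, p⟩ : QuiverPath V) = ⟨b, c, q⟩

namespace IsSelfInjectiveRelation

variable {Z : Set (QuiverPath V)} (hZ : IsSelfInjectiveRelation Z)

include hZ

theorem exists_isRightMaximal_comp {a b : V} (p : Quiver.Path a b) (hp : ⟨a, b, p⟩ ∉ Z) :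
    ∃ (c : V) (q : Quiver.Path b c), IsRightMaximal Z (p.comp q) := by
  obtain ⟨n, hn⟩ := hZ.exists_bound
  induction hd : n - p.length generalizing b with
  | zero => exact absurd (hn p (by omega)) hp
  | succ d ih =>
    by_cases hmax : IsRightMaximal Z p
    · exact ⟨b, .nil, hmax⟩
    · have : ∃ (c : V) (e : b ⟶ c), ⟨a, c, p.cons e⟩ ∉ Z := by
        by_contra! hcon
        exact hmax ⟨hp, hcon⟩
      obtain ⟨c, e, he⟩ := this
      obtain ⟨c', q, hq⟩ := ih (p.cons e) he (by simp; omega)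
      refine ⟨c', e.toPath.comp q, ?_⟩
      rwa [← Quiver.Path.comp_assoc, Quiver.Path.comp_toPath_eq_cons]

/-- Choose a right-maximal path from every vertex. Sending a vertex to the end of the chosen path is
injective, since the end determines the path and hence its start; as there are finitely many
vertices, every vertex is the end of a chosen path, so every right-maximal path is a chosen one. -/
theorem exists_maximalPath [Finite V] : ∃ (t : V → V) (m : ∀ v, Quiver.Path v (t v)),
    Function.Bijective t ∧ (∀ v, IsRightMaximal Z (m v)) ∧
    ∀ {a b : V} (p : Quiver.Path a b), IsRightMaximal Z p →
      (⟨b, p⟩ : Σ b, Quiver.Path a b) = ⟨t a, m a⟩ := by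
  have h₀ : ∀ v : V, ∃ (c : V) (q : Quiver.Path v c), IsRightMaximal Z q := by
    intro v
    obtain ⟨c, q, hq⟩ := hZ.exists_isRightMaximal_comp (Quiver.Path.nil : Quiver.Path v v)
      (fun h => by simpa using hZ.two_le_length _ h)
    exact ⟨c, q, by rwa [Quiver.Path.nil_comp] at hq⟩
  choose t m hm using h₀
  have key : ∀ {a b : V} (v : V) (p : Quiver.Path a b), IsRightMaximal Z p → b = t v →
      (⟨a, b, p⟩ : QuiverPath V) = ⟨v, t v, m v⟩ := by
    rintro a _ v p hp rfl
    exact hZ.eq_of_isRightMaximal _ _ hp (hm v)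
  have ht : Function.Injective t := fun v v' h => congrArg Sigma.fst (key v' (m v) (hm v) h)
  have ht' : Function.Bijective t := ⟨ht, Finite.surjective_of_injective ht⟩
  refine ⟨t, m, ht', hm, fun {a b} p hp => ?_⟩
  obtain ⟨v, hv⟩ := ht'.2 b
  obtain ⟨rfl, h⟩ := Sigma.mk.inj_iff.1 (key v p hp hv.symm)
  exact eq_of_heq h

theorem subsingleton_arrows [Finite V] (a : V) : Subsingleton (Σ b, a ⟶ b) := by
  obtain ⟨t, m, -, -, hm⟩ := hZ.exists_maximalPath
  refine ⟨fun ⟨b, e⟩ ⟨b', e'⟩ => ?_⟩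
  have hne : ∀ {b : V} (e : a ⟶ b), ⟨a, b, e.toPath⟩ ∉ Z := fun e h => by
    simpa using hZ.two_le_length _ h
  obtain ⟨c, q, hq⟩ := hZ.exists_isRightMaximal_comp e.toPath (hne e)
  obtain ⟨c', q', hq'⟩ := hZ.exists_isRightMaximal_comp e'.toPath (hne e')
  obtain ⟨rfl, h⟩ := Sigma.mk.inj_iff.1 ((hm _ hq).trans (hm _ hq').symm)
  obtain ⟨rfl, h'⟩ := Sigma.mk.inj_iff.1
    (Quiver.Path.sigma_eq_of_comp_eq q q' (eq_of_heq h) rfl)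
  have := eq_of_heq (Quiver.Path.hom_heq_of_cons_eq_cons (eq_of_heq h'))
  rw [this]

/-- There are no sinks: at a sink the trivial path is right-maximal, so no arrow can end there
either, and the sink would be isolated. -/
theorem nonempty_arrows (hconn : QuiverConnected V) (harrow : ∃ a b : V, Nonempty (a ⟶ b))
    (v : V) : Nonempty (Σ b, v ⟶ b) := by
  by_contra hv
  have h₁ : ∀ b, (v ⟶ b) → False := fun b e => hv ⟨⟨b, e⟩⟩
  have hnil : IsRightMaximal Z (Quiver.Path.nil : Quiver.Path v v) :=
    ⟨fun h => by simpa using hZ.two_le_length _ h, fun c e => (h₁ c e).elim⟩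
  have h₂ : ∀ a, (a ⟶ v) → False := by
    intro a e
    have he : IsRightMaximal Z e.toPath :=
      ⟨fun h => by simpa using hZ.two_le_length _ h, fun c e => (h₁ c e).elim⟩
    have := congrArg (fun x : QuiverPath V => x.2.2.length)
      (hZ.eq_of_isRightMaximal _ _ he hnil)
    simp at this
  obtain ⟨a, b, ⟨e⟩⟩ := harrow
  have h₃ : a = v ↔ v = v := hconn.iff_of_forall_arrow (P := fun x => x = v)
    (fun c d f => ⟨by rintro rfl; exact (h₁ d f).elim, by rintro rfl; exact (h₂ c f).elim⟩) a v
  obtain rfl := h₃.2 rfl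
  exact h₁ b e

/-- The arrows form the graph of a permutation of the vertices. -/
theorem exists_perm [Finite V] (hconn : QuiverConnected V)
    (harrow : ∃ a b : V, Nonempty (a ⟶ b)) :
    ∃ σ : Equiv.Perm V, ∀ a b : V, Nonempty (a ⟶ b) ↔ b = σ a := by
  have hsub := hZ.subsingleton_arrows
  obtain ⟨t, m, ht, hm, -⟩ := hZ.exists_maximalPath
  let s : ∀ v : V, Σ b, v ⟶ b := fun v => (hZ.nonempty_arrows hconn harrow v).some
  have hs : ∀ a b : V, (a ⟶ b) → b = (s a).1 := fun a b e =>
    congrArg Sigma.fst ((hsub a).elim ⟨b, e⟩ (s a))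
  -- No right-maximal path is trivial, as its start has an outgoing arrow; so every vertex, being the
  -- end of a right-maximal path, is the end of an arrow.
  have hend : ∀ {a b : V} (p : Quiver.Path a b), IsRightMaximal Z p → ∃ v, (s v).1 = b := by
    intro a b p hp
    cases p with
    | nil =>
      have := hZ.two_le_length _ (hp.2 _ (s a).2)
      simp at this
    | cons p e => exact ⟨_, (hs _ _ e).symm⟩
  have hsurj : Function.Surjective fun v => (s v).1 := by
    intro w
    obtain ⟨v, rfl⟩ := ht.2 w
    exact hend (m v) (hm v)
  refine ⟨Equiv.ofBijective _ (Finite.injective_iff_surjective.2 hsurj |>.bijective_of_finite), ?_⟩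
  intro a b
  constructor
  · rintro ⟨e⟩
    exact hs a b e
  · rintro rfl
    exact ⟨(s a).2⟩

/-- The zero paths are exactly the paths of length at least `r`, for some `r`. The lengths of the
maximal paths cannot decrease along an arrow, since otherwise two maximal paths of different
lengths would have the same end; as the arrows permute the vertices, the lengths are constant. -/
theorem exists_mem_iff_le_length [Fintype V] (hconn : QuiverConnected V)
    (harrow : ∃ a b : V, Nonempty (a ⟶ b)) :
    ∃ r : ℕ, 2 ≤ r ∧ ∀ {a b : V} (p : Quiver.Path a b), ⟨a, b, p⟩ ∈ Z ↔ r ≤ p.length := by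
  have hsub := hZ.subsingleton_arrows
  obtain ⟨σ, hσ⟩ := hZ.exists_perm hconn harrow
  obtain ⟨t, m, -, hm, huniq⟩ := hZ.exists_maximalPath
  -- A path is determined by its start and length, so it is nonzero exactly if it is an initial
  -- segment of the maximal path `m a`.
  have hmem : ∀ {a b : V} (p : Quiver.Path a b), ⟨a, b, p⟩ ∈ Z ↔ (m a).length < p.length := by
    intro a b p
    constructor
    · intro hp
      by_contra! hle
      obtain ⟨c, q, r, hqr, hq⟩ := (m a).exists_comp_of_le_length hle
      obtain ⟨rfl, h⟩ := Sigma.mk.inj_iff.1 (Quiver.Path.sigma_eq_of_length_eq hsub q p hq)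
      obtain rfl := eq_of_heq h
      apply (hm a).1
      rw [hqr]
      exact hZ.comp_left _ _ hp
    · intro hlt
      by_contra hp
      obtain ⟨c, q, hq⟩ := hZ.exists_isRightMaximal_comp p hp
      have := congrArg (fun x : Σ b, Quiver.Path a b => x.2.length) (huniq _ hq)
      simp only [Quiver.Path.length_comp] at this
      omega
  have hle : ∀ v, (m v).length ≤ (m (σ v)).length := by
    intro v
    obtain ⟨e⟩ := (hσ v (σ v)).2 rfl
    obtain ⟨c, q, hq⟩ := hZ.exists_isRightMaximal_comp e.toPath
      (fun h => by simpa using hZ.two_le_length _ h)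
    have hl := congrArg (fun x : Σ b, Quiver.Path v b => x.2.length) (huniq _ hq)
    simp only [Quiver.Path.length_comp, Quiver.Path.length_toPath] at hl
    by_contra! hlt
    -- Here `m v` is `e` followed by `q`, and if `m (σ v)` is shorter than `m v`, then `q` is already
    -- right-maximal, with the same end as `m v`.
    have hq' : IsRightMaximal Z q := by
      refine ⟨fun h => hq.1 (hZ.comp_right _ _ h), fun d f => (hmem _).2 ?_⟩
      rw [Quiver.Path.length_cons]
      omega
    have := congrArg (fun x : QuiverPath V => x.2.2.length)
      (hZ.eq_of_isRightMaximal _ _ hq hq')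
    simp at this
  have heq : ∀ v, (m v).length = (m (σ v)).length := by
    have := (Finset.sum_eq_sum_iff_of_le fun v (_ : v ∈ Finset.univ) => hle v).1
      (Equiv.sum_comp σ fun v => (m v).length).symm
    exact fun v => this v (Finset.mem_univ v)
  obtain ⟨a₀, b₀, ⟨e₀⟩⟩ := harrow
  have hconst : ∀ v, (m v).length = (m a₀).length := fun v =>
    (hconn.iff_of_forall_arrow (P := fun x => (m x).length = (m a₀).length)
      (fun c d f => by rw [(hσ c d).1 ⟨f⟩, ← heq c]) v a₀).2 rfl
  refine ⟨(m a₀).length + 1, ?_, fun {a b} p => by rw [hmem, hconst a]; rfl⟩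
  by_contra! hlt
  have := hZ.two_le_length e₀.toPath ((hmem _).2 (by simp; omega))
  simp at this

/-- The arrows permute the vertices, and by connectedness the permutation is a single cycle. -/
theorem exists_quiverIso [Finite V] (hconn : QuiverConnected V)
    (harrow : ∃ a b : V, Nonempty (a ⟶ b)) :
    ∃ m : ℕ, 1 ≤ m ∧ Nonempty (QuiverIso V (OrientedCycle m)) := by
  have hsub := hZ.subsingleton_arrows
  obtain ⟨σ, hσ⟩ := hZ.exists_perm hconn harrow
  obtain ⟨a₀, -, -⟩ := harrow
  have hcycle : ∀ v, σ.SameCycle a₀ v := fun v =>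
    (hconn.iff_of_forall_arrow (P := fun x => σ.SameCycle a₀ x)
      (fun c d f => by rw [(hσ c d).1 ⟨f⟩, Equiv.Perm.sameCycle_apply_right]) v a₀).2
      (Equiv.Perm.SameCycle.refl _ _)
  let m := Function.minimalPeriod (σ • ·) a₀
  let F : ZMod m → V := fun x => ((MulAction.orbitZPowersEquiv σ a₀).symm x : V)
  have hF : ∀ n : ℤ, F n = (σ ^ n) a₀ := fun n => by
    simp only [F]
    rw [MulAction.orbitZPowersEquiv_symm_apply']
    rfl
  have hFbij : Function.Bijective F := by
    refine ⟨Subtype.val_injective.comp (MulAction.orbitZPowersEquiv σ a₀).symm.injective, ?_⟩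
    intro v
    obtain ⟨n, hn⟩ := hcycle v
    exact ⟨n, (hF n).trans hn⟩
  have hFsucc : ∀ x, F (x + 1) = σ (F x) := by
    intro x
    obtain ⟨n, rfl⟩ := ZMod.intCast_surjective x
    have : ((n : ZMod m) + 1) = ((1 + n : ℤ) : ZMod m) := by push_cast; ring
    rw [this, hF, hF, zpow_add, zpow_one, Equiv.Perm.mul_apply]
  let ε : V ≃ ZMod m := (Equiv.ofBijective F hFbij).symm
  have hε : ∀ a b : V, ε b = ε a + 1 ↔ b = σ a := by
    intro a b
    rw [Equiv.symm_apply_eq]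
    change b = F (ε a + 1) ↔ _
    have h : F (ε a) = a := (Equiv.ofBijective F hFbij).apply_symm_apply a
    rw [hFsucc, h]
  have hm : 1 ≤ m := by
    have : Finite (ZMod m) := Finite.of_equiv V ε
    by_contra! h
    have h₀ : m = 0 := by omega
    rw [h₀] at this
    have : Finite ℤ := this
    exact not_finite ℤ
  have hsub' : ∀ a b : V, Subsingleton (a ⟶ b) := fun a b =>
    ⟨fun e e' => eq_of_heq (Sigma.mk.inj_iff.1 ((hsub a).elim ⟨b, e⟩ ⟨b, e'⟩)).2⟩
  refine ⟨m, hm, ⟨ε, fun a b => ?_⟩⟩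
  exact
    { toFun := fun e => PLift.up ((hε a b).2 ((hσ a b).1 ⟨e⟩))
      invFun := fun e => ((hσ a b).2 ((hε a b).1 e.down)).some
      left_inv := fun e => (hsub' a b).elim _ _
      right_inv := fun _ => rfl }

end IsSelfInjectiveRelation

end Combinatorics

/-! ### Monomial algebras of vanishing `φ`-dimension -/

/-- The zero paths of a monomial algebra of vanishing `φ`-dimension. -/
theorem PathAlgebra.isSelfInjectiveRelation {k : Type u} [Field k] {V : Type v} [Quiver.{w} V]
    [Fintype V] [∀ a b : V, Finite (a ⟶ b)] {I : Ideal (PathAlgebra k V)} [IsAdmissible I]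
    (hI : IsMonomial I) (hphi : IgusaTodorov.phiDim (PathAlgebra k V ⧸ I)ᵐᵒᵖ = 0) :
    IsSelfInjectiveRelation {x : QuiverPath V | ofPath k x ∈ I} where
  comp_left p q := ofPath_comp_mem_left p q
  comp_right p q := ofPath_comp_mem_right p q
  two_le_length p hp := ofPath_mem_pathSpan_iff.1
    ((mem_arrowIdeal_pow_iff 2).1 (IsAdmissible.le_sq (I := I) hp))
  exists_bound := by
    obtain ⟨n, hn⟩ := IsAdmissible.exists_pow_le (I := I)
    exact ⟨n, fun p hp => hn (ofPath_mem_pow n p hp)⟩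
  eq_of_isRightMaximal p q hp hq := PathAlgebra.eq_of_isRightMaximal hI hphi hp hq

theorem mainTheorem7 {k : Type u} [Field k] {V : Type v} [Quiver.{w} V] [Fintype V]
    [∀ a b : V, Finite (a ⟶ b)] (hconn : QuiverConnected V)
    (I : Ideal (PathAlgebra k V)) [PathAlgebra.IsAdmissible I] (hI : PathAlgebra.IsMonomial I)
    (harrow : ∃ a b : V, Nonempty (a ⟶ b))
    (hphi : IgusaTodorov.phiDim (PathAlgebra k V ⧸ I)ᵐᵒᵖ = 0) :
    (∃ m : ℕ, 1 ≤ m ∧ Nonempty (QuiverIso V (OrientedCycle m))) ∧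
      ∃ r : ℕ, 2 ≤ r ∧ I = PathAlgebra.arrowIdeal k V ^ r := by
  have hZ := PathAlgebra.isSelfInjectiveRelation hI hphi
  refine ⟨hZ.exists_quiverIso hconn harrow, ?_⟩
  obtain ⟨r, hr, hmem⟩ := hZ.exists_mem_iff_le_length hconn harrow
  refine ⟨r, hr, Ideal.ext fun f => ?_⟩
  have hset : {x : QuiverPath V | PathAlgebra.ofPath k x ∈ I} = {x | r ≤ x.2.2.length} :=
    Set.ext fun x => hmem x.2.2
  rw [hI.mem_iff, PathAlgebra.mem_arrowIdeal_pow_iff, hset]
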